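/- Let $n\ge 1$. For $f:\mathbb{R}^n\to\mathbb{R}$ in $L^1(\mathbb{R}^n)$ let $$\|f\|_{BV}=|Df|(\mathbb{R}^n)=\sup\Big\{\int_{\mathbb{R}^n} f\,\operatorname{div}\varphi\,dx:\ \varphi\in C^1_c(\mathbb{R}^n;\mathbb{R}^n),\ |\varphi|\le 1\Big\}$$ denote its total variation, and let $BV(\mathbb{R}^n)$ be the set of $f\in L^1(\mathbb{R}^n)$ with $\|f\|_{BV}<\infty$. For $\alpha\in(0,1)$ put $$\|f\|_{\dot\Lambda^{1,\infty}_\alpha}=\sup_{h\in\mathbb{R}^n\setminus\{0\}}|h|^{-\alpha}\,\|\Delta_h f\|_{L^1(\mathbb{R}^n)}\in[0,\infty],\qquad \Delta_hf(x)=f(x+h)-f(x).$$ Then there is a constant $c\in(0,\infty)$, depending only on $n$, such that for every $f\in BV(\mathbb{R}^n)$ $$\limsup_{\alpha\to1^-}\|f\|_{\dot\Lambda^{1,\infty}_\alpha}\le c\,\|f\|_{BV}.$$ (Since $|Df|(\mathbb{R}^n)\le\|f\|_{L^1}+|Df|(\mathbb{R}^n)$, the same bound then holds with the inhomogeneous norm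 $\|f\|_{L^1}+|Df|(\mathbb{R}^n)$ on the right.) -/

import Mathlib

open scoped ENNReal NNReal Topology

noncomputable section

namespace BesovBV

/-- The difference operator `Δ_h f (x) = f (x + h) - f x` on functions on `ℝⁿ`. -/
def diffOp {n : ℕ} (h : EuclideanSpace ℝ (Fin n)) (f : EuclideanSpace ℝ (Fin n) → ℝ) :
    EuclideanSpace ℝ (Fin n) → ℝ :=
  fun x => f (x + h) - f x

/-- The homogeneous `∞`-Besov (semi)norm
`sup_{h ≠ 0} |h|^{-α} ‖Δ_h f‖_{L^p}`, with values in `[0, ∞]`. -/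
def besovNorm {n : ℕ} (α : ℝ) (p : ℝ≥0∞) (f : EuclideanSpace ℝ (Fin n) → ℝ) : ℝ≥0∞ :=
  ⨆ (h : EuclideanSpace ℝ (Fin n)) (_ : h ≠ 0),
    ENNReal.ofReal (‖h‖ ^ (-α)) * MeasureTheory.eLpNorm (diffOp h f) p MeasureTheory.volume

/-- The divergence `∑ i, ∂ᵢ φᵢ` of a vector field on `ℝⁿ`. -/
def divergence {n : ℕ} (φ : EuclideanSpace ℝ (Fin n) → EuclideanSpace ℝ (Fin n))
    (x : EuclideanSpace ℝ (Fin n)) : ℝ :=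
  ∑ i : Fin n, (fderiv ℝ φ x (EuclideanSpace.single i 1)) i

/-- Admissible test fields: `φ ∈ C¹_c(ℝⁿ; ℝⁿ)` with `|φ| ≤ 1` in the Euclidean norm. -/
structure IsTestField {n : ℕ}
    (φ : EuclideanSpace ℝ (Fin n) → EuclideanSpace ℝ (Fin n)) : Prop where
  contDiff : ContDiff ℝ 1 φ
  hasCompactSupport : HasCompactSupport φ
  norm_le_one : ∀ x, ‖φ x‖ ≤ 1

/-- The total variation `|Df|(ℝⁿ) = sup {∫ f div φ : φ ∈ C¹_c(ℝⁿ; ℝⁿ), |φ| ≤ 1}` of an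
integrable function, with values in `[0, ∞]`. As `φ` and `-φ` are admissible together, the
truncation of negative values by `ENNReal.ofReal` does not affect the supremum. -/
def totalVariation {n : ℕ} (f : EuclideanSpace ℝ (Fin n) → ℝ) : ℝ≥0∞ :=
  ⨆ (φ : EuclideanSpace ℝ (Fin n) → EuclideanSpace ℝ (Fin n)) (_ : IsTestField φ),
    ENNReal.ofReal (∫ x, f x * divergence φ x)

/-- `f ∈ BV(ℝⁿ)`: `f ∈ L¹(ℝⁿ)` and its total variation is finite. -/
structure IsBV {n : ℕ} (f : EuclideanSpace ℝ (Fin n) → ℝ) : Prop where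
  memLp : MeasureTheory.MemLp f 1 MeasureTheory.volume
  totalVariation_lt_top : totalVariation f < ∞

end BesovBV

end

open MeasureTheory Filter

namespace BesovBV

/-! Translation is Lipschitz in `L¹` on BV: `‖Δ_h f‖₁ ≤ |h| |Df|(ℝⁿ)`, by duality with test
functions and differentiation along the segment from `0` to `h` (`IsBV.eLpNorm_diffOp_le`). Taking
the power `α` of this bound and the power `1 - α` of `‖Δ_h f‖₁ ≤ 2‖f‖₁` cancels `|h|^(-α)` exactly
(`IsBV.besovNorm_le`). As `α → 1⁻` the `L¹` factor tends to `1`, so `c = 1` works in every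
dimension. -/

/-- The `L¹` norm of an integrable function is controlled by its pairings with compactly supported
`C¹` functions bounded by one. -/
theorem integral_abs_le_of_forall_contDiff {E : Type*} [NormedAddCommGroup E] [NormedSpace ℝ E]
    [FiniteDimensional ℝ E] [MeasurableSpace E] [BorelSpace E] {μ : Measure E}
    [μ.IsAddHaarMeasure] {g : E → ℝ} (hg : Integrable g μ) {K : ℝ}
    (h : ∀ φ : E → ℝ, ContDiff ℝ 1 φ → HasCompactSupport φ → (∀ x, |φ x| ≤ 1) →
      ∫ x, g x * φ x ∂μ ≤ K) :
    ∫ x, |g x| ∂μ ≤ K := by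
  refine le_of_forall_pos_le_add fun δ hδ => ?_
  obtain ⟨u, hu_supp, hu_smooth, hu⟩ :=
    (memLp_one_iff_integrable.2 hg).exist_eLpNorm_sub_le (by simp) le_rfl
      (show (0 : ℝ) < δ / 3 by positivity)
  set m : ℝ := μ.real (tsupport u) with hm
  have hm0 : 0 ≤ m := measureReal_nonneg
  -- The `+ 1` allows for a support of measure zero.
  set ε : ℝ := δ / 3 / (m + 1) with hε
  have hε0 : 0 < ε := by positivity
  have hεm : ε * m ≤ δ / 3 := by
    rw [hε, div_mul_eq_mul_div, div_le_iff₀ (by positivity)]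
    nlinarith
  have hpos (x : E) : 0 < u x ^ 2 + ε ^ 2 := by positivity
  have hsqrt (x : E) : 0 < √(u x ^ 2 + ε ^ 2) := Real.sqrt_pos.2 (hpos x)
  -- A `C¹` substitute for the sign of `u`: it vanishes where `u` does, and `u ψ` falls short of
  -- `|u|` by at most `ε`.
  let ψ : E → ℝ := fun x => u x / √(u x ^ 2 + ε ^ 2)
  have hu1 : ContDiff ℝ 1 u := hu_smooth.of_le (by exact_mod_cast le_top)
  have hψ : ContDiff ℝ 1 ψ :=
    hu1.div (((hu1.pow 2).add contDiff_const).sqrt fun x => (hpos x).ne') fun x => (hsqrt x).ne'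
  have hψ_supp : HasCompactSupport ψ := hu_supp.mono fun x hx => by
    contrapose! hx
    simp_all [ψ]
  have habs (x : E) : |u x| ≤ √(u x ^ 2 + ε ^ 2) :=
    Real.abs_le_sqrt (by nlinarith [sq_nonneg ε])
  have hψ1 (x : E) : |ψ x| ≤ 1 := by
    simp only [ψ, abs_div, abs_of_pos (hsqrt x)]
    exact (div_le_one (hsqrt x)).2 (habs x)
  have huψ (x : E) : |u x| ≤ u x * ψ x + (tsupport u).indicator (fun _ => ε) x := by
    by_cases hx : x ∈ tsupport u
    · rw [Set.indicator_of_mem hx]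
      have h1 : √(u x ^ 2 + ε ^ 2) ≤ |u x| + ε := by
        rw [Real.sqrt_le_iff]
        exact ⟨by positivity, by nlinarith [sq_abs (u x), abs_nonneg (u x)]⟩
      have h2 : u x * ψ x = |u x| ^ 2 / √(u x ^ 2 + ε ^ 2) := by
        simp only [ψ, sq_abs]
        ring
      rw [h2, ← sub_le_iff_le_add, le_div_iff₀ (hsqrt x)]
      have h3 := abs_nonneg (u x)
      rcases le_total ε |u x| with h4 | h4
      · nlinarith [mul_le_mul_of_nonneg_left h1 (sub_nonneg.2 h4)]
      · nlinarith [mul_nonneg (sub_nonneg.2 h4) (hsqrt x).le]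
    · simp [image_eq_zero_of_notMem_tsupport hx, Set.indicator_of_notMem hx]
  have hu_int : Integrable u μ := hu1.continuous.integrable_of_hasCompactSupport hu_supp
  have hgu : ∫ x, |g x - u x| ∂μ ≤ δ / 3 := by
    have := (hg.sub hu_int)
    rw [eLpNorm_one_eq_lintegral_enorm, ← ofReal_integral_norm_eq_lintegral_enorm this] at hu
    exact (ENNReal.ofReal_le_ofReal_iff (by positivity)).1 hu
  have hgψ : Integrable (fun x => g x * ψ x) μ :=
    hg.mul_bdd (c := 1) hψ.continuous.aestronglyMeasurable (.of_forall hψ1)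
  have hind : Integrable ((tsupport u).indicator fun _ => ε) μ :=
    (integrable_indicator_iff hu_supp.isClosed.measurableSet).2
      (integrableOn_const hu_supp.measure_lt_top.ne)
  have hsub : Integrable (fun x => |g x - u x|) μ := (hg.sub hu_int).abs
  -- Replacing `g` by `u` costs `|g - u|` twice: once in `|g|`, once in the pairing with `ψ`.
  have hpt (x : E) :
      |g x| ≤ g x * ψ x + 2 * |g x - u x| + (tsupport u).indicator (fun _ => ε) x := by
    have h1 : |g x| ≤ |g x - u x| + |u x| := by simpa using abs_add_le (g x - u x) (u x)
    have h2 : (u x - g x) * ψ x ≤ |g x - u x| := by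
      refine (le_abs_self _).trans ?_
      rw [abs_mul, abs_sub_comm]
      exact mul_le_of_le_one_right (abs_nonneg _) (hψ1 x)
    linarith [huψ x]
  calc ∫ x, |g x| ∂μ
      ≤ ∫ x, (g x * ψ x + 2 * |g x - u x| + (tsupport u).indicator (fun _ => ε) x) ∂μ :=
        integral_mono hg.abs ((hgψ.add (hsub.const_mul 2)).add hind) hpt
    _ = ∫ x, g x * ψ x ∂μ + 2 * ∫ x, |g x - u x| ∂μ + m * ε := by
        rw [integral_add (f := fun x => g x * ψ x + 2 * |g x - u x|) (hgψ.add (hsub.const_mul 2)) hind,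
          integral_add hgψ (hsub.const_mul 2),
          integral_const_mul, integral_indicator hu_supp.isClosed.measurableSet]
        simp [hm]
    _ ≤ K + δ := by linarith [h ψ hψ hψ_supp hψ1]

variable {n : ℕ} {f : EuclideanSpace ℝ (Fin n) → ℝ}

theorem divergence_smul_const {φ : EuclideanSpace ℝ (Fin n) → ℝ} {x : EuclideanSpace ℝ (Fin n)}
    (hφ : DifferentiableAt ℝ φ x) (v : EuclideanSpace ℝ (Fin n)) :
    divergence (fun y => φ y • v) x = fderiv ℝ φ x v := by
  have hv : v = ∑ i, v i • EuclideanSpace.single i (1 : ℝ) := by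
    simpa using ((EuclideanSpace.basisFun (Fin n) ℝ).sum_repr v).symm
  conv_rhs => rw [hv]
  simp [divergence, fderiv_smul_const hφ, mul_comm]

/-- The distributional derivative of a `BV` function in direction `v` has mass at most
`‖v‖ |Df|(ℝⁿ)`. -/
theorem IsBV.integral_mul_fderiv_le (hf : IsBV f) {φ : EuclideanSpace ℝ (Fin n) → ℝ}
    (hφ : ContDiff ℝ 1 φ) (hφ_supp : HasCompactSupport φ) (hφ1 : ∀ x, |φ x| ≤ 1)
    (v : EuclideanSpace ℝ (Fin n)) :
    ∫ x, f x * fderiv ℝ φ x v ≤ ‖v‖ * (totalVariation f).toReal := by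
  rcases eq_or_ne v 0 with rfl | hv
  · simp
  have hv0 : 0 < ‖v‖ := norm_pos_iff.2 hv
  set w : EuclideanSpace ℝ (Fin n) := ‖v‖⁻¹ • v with hw
  have hvw : v = ‖v‖ • w := by rw [hw, smul_inv_smul₀ hv0.ne']
  have hw1 : ‖w‖ = 1 := by rw [hw, norm_smul, norm_inv, norm_norm, inv_mul_cancel₀ hv0.ne']
  have htest : IsTestField (fun x => φ x • w) :=
    ⟨hφ.smul contDiff_const, hφ_supp.smul_right, fun x => by simpa [norm_smul, hw1] using hφ1 x⟩
  have hle : ENNReal.ofReal (∫ x, f x * divergence (fun y => φ y • w) x) ≤ totalVariation f :=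
    le_iSup₂ (f := fun (φ : EuclideanSpace ℝ (Fin n) → EuclideanSpace ℝ (Fin n))
      (_ : IsTestField φ) => ENNReal.ofReal (∫ x, f x * divergence φ x)) _ htest
  have hle' := (ENNReal.ofReal_le_iff_le_toReal hf.totalVariation_lt_top.ne).1 hle
  simp only [divergence_smul_const (hφ.differentiable one_ne_zero _)] at hle'
  have heq : ∀ x, f x * fderiv ℝ φ x v = ‖v‖ * (f x * fderiv ℝ φ x w) := fun x => by
    conv_lhs => rw [hvw, map_smul, smul_eq_mul]
    ring
  simp only [heq, integral_const_mul]
  gcongr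

/-- Pairing a `BV` function with the difference of a test function and its translate. -/
theorem IsBV.integral_mul_translate_sub_le (hf : IsBV f) {φ : EuclideanSpace ℝ (Fin n) → ℝ}
    (hφ : ContDiff ℝ 1 φ) (hφ_supp : HasCompactSupport φ) (hφ1 : ∀ x, |φ x| ≤ 1)
    (v : EuclideanSpace ℝ (Fin n)) :
    (∫ x, f x * φ (x + v)) - ∫ x, f x * φ x ≤ ‖v‖ * (totalVariation f).toReal := by
  have hf_int : Integrable f := memLp_one_iff_integrable.1 hf.memLp
  have hφ' : Continuous (fderiv ℝ φ) := hφ.continuous_fderiv one_ne_zero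
  obtain ⟨C, hC⟩ := (hφ_supp.fderiv (𝕜 := ℝ)).exists_bound_of_continuous hφ'
  -- The derivative falls on `φ`, so `f` needs no regularity. Each translate of `φ` is again
  -- admissible, which bounds the derivative uniformly in `t`; the mean value inequality on `[0, 1]`
  -- concludes.
  have hderiv (t : ℝ) : HasDerivAt (fun t : ℝ => ∫ x, f x * φ (x + t • v))
      (∫ x, f x * fderiv ℝ φ (x + t • v) v) t := by
    refine (hasDerivAt_integral_of_dominated_loc_of_deriv_le (s := Set.univ)
      (F' := fun t x => f x * fderiv ℝ φ (x + t • v) v)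
      (bound := fun x => ‖f x‖ * (C * ‖v‖)) univ_mem (.of_forall fun s => ?_) ?_ ?_ ?_ ?_ ?_).2
    · exact hf_int.1.mul (hφ.continuous.comp (by fun_prop)).aestronglyMeasurable
    · exact hf_int.mul_bdd (c := 1) (hφ.continuous.comp (by fun_prop)).aestronglyMeasurable
        (.of_forall fun x => hφ1 _)
    · exact hf_int.1.mul ((hφ'.comp (by fun_prop)).clm_apply
        continuous_const).aestronglyMeasurable
    · refine .of_forall fun x s _ => ?_
      rw [norm_mul]
      gcongr
      exact (fderiv ℝ φ _).le_of_opNorm_le (hC _) v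
    · exact hf_int.norm.mul_const _
    · refine .of_forall fun x s _ => ?_
      have h1 : HasDerivAt (fun t : ℝ => x + t • v) v s := by
        simpa using ((hasDerivAt_id s).smul_const v).const_add x
      exact ((hφ.differentiable one_ne_zero _).hasFDerivAt.comp_hasDerivAt s h1).const_mul (f x)
  have hbound (t : ℝ) : deriv (fun t : ℝ => ∫ x, f x * φ (x + t • v)) t ≤
      ‖v‖ * (totalVariation f).toReal := by
    rw [(hderiv t).deriv]
    simpa only [fderiv_comp_add_right] using
      hf.integral_mul_fderiv_le (φ := fun x => φ (x + t • v)) (hφ.comp (by fun_prop))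
        (hφ_supp.comp_homeomorph (Homeomorph.addRight (t • v))) (fun x => hφ1 _) v
  simpa [-tsub_le_iff_right] using image_sub_le_mul_sub_of_deriv_le (fun t => (hderiv t).differentiableAt) hbound
    zero_le_one

/-- Translates of a `BV` function are Lipschitz in `L¹`. -/
theorem IsBV.eLpNorm_diffOp_le (hf : IsBV f) (h : EuclideanSpace ℝ (Fin n)) :
    eLpNorm (diffOp h f) 1 volume ≤ ENNReal.ofReal ‖h‖ * totalVariation f := by
  have hf_int : Integrable f := memLp_one_iff_integrable.1 hf.memLp
  have hfh : Integrable (fun x => f (x + h)) := hf_int.comp_add_right h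
  have hdiff : Integrable (diffOp h f) := hfh.sub hf_int
  have key : ∫ x, |diffOp h f x| ≤ ‖h‖ * (totalVariation f).toReal := by
    refine integral_abs_le_of_forall_contDiff hdiff fun φ hφ hφ_supp hφ1 => ?_
    have h1 : Integrable (fun x => f x * φ x) :=
      hf_int.mul_bdd (c := 1) hφ.continuous.aestronglyMeasurable (.of_forall hφ1)
    have h2 : Integrable (fun x => f (x + h) * φ x) :=
      hfh.mul_bdd (c := 1) hφ.continuous.aestronglyMeasurable (.of_forall hφ1)
    have h3 : ∫ x, f (x + h) * φ x = ∫ x, f x * φ (x + -h) := by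
      rw [← integral_add_right_eq_self (fun x => f x * φ (x + -h)) h]
      simp
    simp only [diffOp, sub_mul]
    rw [integral_sub h2 h1, h3]
    simpa [-tsub_le_iff_right] using hf.integral_mul_translate_sub_le hφ hφ_supp hφ1 (-h)
  rw [eLpNorm_one_eq_lintegral_enorm, ← ofReal_integral_norm_eq_lintegral_enorm hdiff,
    ← ENNReal.ofReal_toReal hf.totalVariation_lt_top.ne, ← ENNReal.ofReal_mul (norm_nonneg h)]
  exact ENNReal.ofReal_le_ofReal key

theorem eLpNorm_diffOp_le_two_mul (hf : MemLp f 1 volume) (h : EuclideanSpace ℝ (Fin n)) :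
    eLpNorm (diffOp h f) 1 volume ≤ 2 * eLpNorm f 1 volume := by
  have hmp := measurePreserving_add_right (volume : Measure (EuclideanSpace ℝ (Fin n))) h
  have h1 : eLpNorm (fun x => f (x + h)) 1 volume = eLpNorm f 1 volume :=
    eLpNorm_comp_measurePreserving hf.1 hmp
  calc eLpNorm (diffOp h f) 1 volume
      ≤ eLpNorm (fun x => f (x + h)) 1 volume + eLpNorm f 1 volume :=
        eLpNorm_sub_le (hf.1.comp_measurePreserving hmp) hf.1 le_rfl
    _ = 2 * eLpNorm f 1 volume := by rw [h1, two_mul]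

/-- Interpolation between the bounds of `Δ_h f` by the total variation and by the `L¹` norm. -/
theorem IsBV.besovNorm_le (hf : IsBV f) {α : ℝ} (hα0 : 0 ≤ α) (hα1 : α ≤ 1) :
    besovNorm α 1 f ≤
      totalVariation f ^ α * (2 * eLpNorm f 1 volume + 1) ^ (1 - α) := by
  refine iSup₂_le fun h hh => ?_
  have hh0 : 0 < ‖h‖ := norm_pos_iff.2 hh
  calc ENNReal.ofReal (‖h‖ ^ (-α)) * eLpNorm (diffOp h f) 1 volume
      = ENNReal.ofReal (‖h‖ ^ (-α)) *
          (eLpNorm (diffOp h f) 1 volume ^ α * eLpNorm (diffOp h f) 1 volume ^ (1 - α)) := by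
        rw [← ENNReal.rpow_add_of_nonneg _ _ hα0 (sub_nonneg.2 hα1), add_sub_cancel,
          ENNReal.rpow_one]
    _ ≤ ENNReal.ofReal (‖h‖ ^ (-α)) * ((ENNReal.ofReal ‖h‖ * totalVariation f) ^ α *
          (2 * eLpNorm f 1 volume + 1) ^ (1 - α)) := by
        gcongr
        · exact hf.eLpNorm_diffOp_le h
        · exact (eLpNorm_diffOp_le_two_mul hf.memLp h).trans le_self_add
    _ = totalVariation f ^ α * (2 * eLpNorm f 1 volume + 1) ^ (1 - α) := by
        rw [ENNReal.mul_rpow_of_nonneg _ _ hα0, ENNReal.ofReal_rpow_of_pos hh0, ← mul_assoc,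
          ← mul_assoc, ← ENNReal.ofReal_mul (by positivity), ← Real.rpow_add hh0]
        simp

theorem IsBV.limsup_besovNorm_le (hf : IsBV f) :
    limsup (fun α : ℝ => besovNorm α 1 f) (𝓝[<] (1 : ℝ)) ≤ totalVariation f := by
  lift totalVariation f to ℝ≥0 using hf.totalVariation_lt_top.ne with V hV
  have hM : 2 * eLpNorm f 1 volume + 1 ≠ ∞ := by
    finiteness [hf.memLp.2]
  obtain ⟨M, hM'⟩ : ∃ M : ℝ≥0, (M : ℝ≥0∞) = 2 * eLpNorm f 1 volume + 1 :=
    ⟨_, ENNReal.coe_toNNReal hM⟩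
  -- The `+ 1` in `besovNorm_le` serves here: `1 - α` tends to `0`, where the power is continuous in
  -- the exponent only for a nonzero base. `V` may vanish, since its exponent tends to `1`.
  have hM0 : M ≠ 0 := by
    rintro rfl
    exact absurd hM'.symm (by simp)
  have hle : ∀ᶠ α : ℝ in 𝓝[<] 1, besovNorm α 1 f ≤ ((V ^ α * M ^ (1 - α) : ℝ≥0) : ℝ≥0∞) := by
    filter_upwards [Ioo_mem_nhdsLT (zero_lt_one' ℝ)] with α hα
    have := hf.besovNorm_le hα.1.le hα.2.le
    rw [← hV, ← hM', ← ENNReal.coe_rpow_of_nonneg _ hα.1.le,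
      ← ENNReal.coe_rpow_of_ne_zero hM0] at this
    exact_mod_cast this
  have hlim : Tendsto (fun α : ℝ => V ^ α * M ^ (1 - α)) (𝓝[<] 1) (𝓝 V) := by
    have h1 : Tendsto (fun α : ℝ => V ^ α) (𝓝 1) (𝓝 (V ^ (1 : ℝ))) :=
      tendsto_const_nhds.nnrpow tendsto_id (.inr one_pos)
    have h2 : Tendsto (fun α : ℝ => M ^ (1 - α)) (𝓝 1) (𝓝 (M ^ (1 - 1 : ℝ))) :=
      tendsto_const_nhds.nnrpow (tendsto_const_nhds.sub tendsto_id) (.inl hM0)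
    simpa using (h1.mul h2).mono_left nhdsWithin_le_nhds
  exact (limsup_le_limsup hle).trans (ENNReal.tendsto_coe.2 hlim).limsup_eq.le

end BesovBV

theorem mainTheorem1 (n : ℕ) (hn : 1 ≤ n) :
    ∃ c : ℝ≥0, 0 < c ∧ ∀ f : EuclideanSpace ℝ (Fin n) → ℝ, BesovBV.IsBV f →
      Filter.limsup (fun α : ℝ => BesovBV.besovNorm α 1 f) (𝓝[<] (1 : ℝ)) ≤
        (c : ℝ≥0∞) * BesovBV.totalVariation f := by
  exact ⟨1, one_pos, fun f hf => by simpa using hf.limsup_besovNorm_le⟩
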